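/- Let $(\Omega,\mathcal F,\mu)$ be a probability space, and for an integrable function $h$ write $\mathbb E h=\int_\Omega h\,d\mu$. For $1\le p\le\infty$ let $\|\cdot\|_p$ denote the norm of $L^p(\Omega,\mu)$ (the essential supremum norm if $p=\infty$). Let $f,g\in L^\infty(\Omega,\mu)$ be real-valued and let $r,p_1,q_1,p_2,q_2\in[1,\infty]$ satisfy $$\frac1r=\frac1{p_1}+\frac1{q_1}=\frac1{p_2}+\frac1{q_2},$$ where $1/\infty=0$. Then $$\|fg-\mathbb E(fg)\|_r\le\|f\|_{p_1}\,\|g-\mathbb Eg\|_{q_1}+\|g\|_{p_2}\,\|f-\mathbb Ef\|_{q_2}.$$ -/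

import Mathlib

/-!
Put `F = f - 𝔼 f`, `G = g - 𝔼 g`. Then `fg - 𝔼(fg)` is half the sum of `S(f, G)` and `S(g, F)`, where
`S(f, G) = f G + 𝔼 f · G - 𝔼(f G)`, so it suffices to show `‖S(f, G)‖_r ≤ 2 ‖f‖_p ‖G‖_q` for
`1/r = 1/p + 1/q` and `𝔼 G = 0` (`eLpNorm_centered_mul_le`).

As `G` has mean zero, `S(f, G)(x) = 𝔼_y R(x, y)` with the kernel
`R(x, y) = f(x) G(x) + f(y) G(x) + f(x) G(y) - f(y) G(y)`, so Jensen's inequality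
(`eLpNorm_integral_prod_le`) gives `‖S(f, G)‖_r ≤ ‖R‖_{L^r(μ × μ)}`. The kernel has the shape of the
CHSH expression, and for real numbers this yields a sharp two-point estimate: the pair
`(|R(x, y)|, |R(y, x)|)` is weakly majorized by twice the pair of products of the decreasing
rearrangements of `(|f(x)|, |f(y)|)` and `(|G(x)|, |G(y)|)`. Let `G̃(x, y)` be the entry of the pair
`(|G(x)|, |G(y)|)` that is matched to `f(x)` when the pair is ordered in the same way as
`(|f(x)|, |f(y)|)`. Weak majorization on each orbit `{(x, y), (y, x)}` is inherited by `L^r` norms on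
the square (`eLpNorm_le_of_swap_majorized`), so Hölder's inequality on `Ω × Ω` concludes:
`‖R‖_r ≤ 2 ‖f(x) G̃(x, y)‖_r ≤ 2 ‖f‖_p ‖G̃‖_q ≤ 2 ‖f‖_p ‖G‖_q`.
-/

open MeasureTheory

/-! ### Two-point inequalities -/

/-- Powers `s ≥ 1` respect weak majorization of pairs of nonnegative reals. -/
theorem rpow_add_rpow_le_of_majorized {a b c d s : ℝ} (ha : 0 ≤ a) (hb : 0 ≤ b) (hc : 0 ≤ c)
    (hd : 0 ≤ d) (hs : 1 ≤ s) (ham : a ≤ max c d) (hbm : b ≤ max c d) (hsum : a + b ≤ c + d) :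
    a ^ s + b ^ s ≤ c ^ s + d ^ s := by
  have hs0 : 0 ≤ s := by linarith
  wlog hdc : d ≤ c generalizing c d
  · have := this hd hc (by rwa [max_comm]) (by rwa [max_comm]) (by linarith) (le_of_not_ge hdc)
    linarith
  wlog hba : b ≤ a generalizing a b
  · have := this hb ha hbm ham (by linarith) (le_of_not_ge hba)
    linarith
  rw [max_eq_left hdc] at ham hbm
  rcases le_or_gt a d with had | had
  · exact add_le_add (Real.rpow_le_rpow ha (had.trans hdc) hs0)
      (Real.rpow_le_rpow hb (hba.trans had) hs0)
  have hcd : 0 < c - d := by linarith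
  -- `a = t c + (1 - t) d`, and then `b ≤ (1 - t) c + t d`.
  obtain ⟨t, ht⟩ : ∃ t, t = (a - d) / (c - d) := ⟨_, rfl⟩
  have htm : t * (c - d) = a - d := by rw [ht]; field_simp
  have ht0 : 0 ≤ t := by rw [ht]; exact div_nonneg (by linarith) hcd.le
  have ht1 : t ≤ 1 := by rw [ht, div_le_one hcd]; linarith
  have hconv := (convexOn_rpow hs).2
  have h1 := hconv (x := c) hc (y := d) hd (a := t) (b := 1 - t) ht0 (by linarith) (by ring)
  have h2 := hconv (x := c) hc (y := d) hd (a := 1 - t) (b := t) (by linarith) ht0 (by ring)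
  simp only [smul_eq_mul] at h1 h2
  have e1 : a ^ s ≤ (t * c + (1 - t) * d) ^ s := Real.rpow_le_rpow ha (by linarith) hs0
  have e2 : b ^ s ≤ ((1 - t) * c + t * d) ^ s := Real.rpow_le_rpow hb (by linarith) hs0
  linarith

/-- The CHSH inequality. With `a = f(x)`, `b = f(y)`, `c = G(x)`, `d = G(y)` it bounds the kernel
`f(x) G(x) + f(y) G(x) + f(x) G(y) - f(y) G(y)` by `2 MN` if `|f| ≤ M` and `|G| ≤ N`. -/
theorem abs_kernel_le {a b c d M N : ℝ} (ha : |a| ≤ M) (hb : |b| ≤ M) (hc : |c| ≤ N)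
    (hd : |d| ≤ N) : |a * c + b * c + a * d - b * d| ≤ 2 * (M * N) := by
  have hM : 0 ≤ M := (abs_nonneg a).trans ha
  have hsum : |a + b| + |a - b| ≤ 2 * M := by
    rw [abs_le] at ha hb
    rcases abs_cases (a + b) with h | h <;> rcases abs_cases (a - b) with h' | h' <;> linarith
  calc |a * c + b * c + a * d - b * d| = |(a + b) * c + (a - b) * d| := by ring_nf
    _ ≤ |a + b| * |c| + |a - b| * |d| := by
      rw [← abs_mul, ← abs_mul]; exact abs_add_le _ _
    _ ≤ |a + b| * N + |a - b| * N := by gcongr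
    _ = (|a + b| + |a - b|) * N := by ring
    _ ≤ 2 * M * N := by
      gcongr
      exact (abs_nonneg c).trans hc
    _ = _ := by ring

/-- The kernel at `(x, y)` and at `(y, x)` has absolute values adding up to at most twice the larger
of the two sums of products, by `|u| + |v| = max |u + v| |u - v|`. -/
theorem abs_kernel_add_abs_kernel_swap_le (a b c d : ℝ) :
    |a * c + b * c + a * d - b * d| + |b * d + a * d + b * c - a * c| ≤
      2 * max (|a| * |c| + |b| * |d|) (|a| * |d| + |b| * |c|) := by
  have h1 : |a * c - b * d| ≤ |a| * |c| + |b| * |d| := by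
    rw [← abs_mul, ← abs_mul]; exact abs_sub _ _
  have h2 : |a * d + b * c| ≤ |a| * |d| + |b| * |c| := by
    rw [← abs_mul, ← abs_mul]; exact abs_add_le _ _
  have h3 := h1.trans (le_max_left _ (|a| * |d| + |b| * |c|))
  have h4 := h2.trans (le_max_right (|a| * |c| + |b| * |d|) _)
  rw [abs_le] at h3 h4
  rcases abs_cases (a * c + b * c + a * d - b * d) with h | h <;>
    rcases abs_cases (b * d + a * d + b * c - a * c) with h' | h' <;> linarith

/-- The entry of `(|c|, |d|)` matched to `a` when this pair is ordered in the same way as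
`(|a|, |b|)`; if `|a| = |b|` it is left unordered, so that exchanging the two points always gives
the other entry. -/
noncomputable def matchedAbs (a b c d : ℝ) : ℝ :=
  if |b| < |a| then max |c| |d| else if |a| < |b| then min |c| |d| else |c|

theorem matchedAbs_nonneg (a b c d : ℝ) : 0 ≤ matchedAbs a b c d := by
  unfold matchedAbs
  split_ifs <;> positivity

theorem matchedAbs_cases (a b c d : ℝ) :
    (matchedAbs a b c d = |c| ∧ matchedAbs b a d c = |d|) ∨
      (matchedAbs a b c d = |d| ∧ matchedAbs b a d c = |c|) := by
  unfold matchedAbs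
  rcases lt_trichotomy |a| |b| with h | h | h <;> rcases le_total |c| |d| with h' | h' <;>
    simp [h, h.not_gt, h']

theorem abs_kernel_le_max_matchedAbs (a b c d : ℝ) :
    |a * c + b * c + a * d - b * d| ≤
      max (2 * (|a| * matchedAbs a b c d)) (2 * (|b| * matchedAbs b a d c)) := by
  refine (abs_kernel_le (le_max_left _ _) (le_max_right _ _) (le_max_left _ _)
    (le_max_right _ _)).trans ?_
  unfold matchedAbs
  rcases lt_trichotomy |a| |b| with h | h | h
  · simp [h, h.not_gt, h.le, max_comm]
  · rcases le_total |c| |d| with h' | h' <;> simp [h, h']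
  · simp [h, h.not_gt, h.le]

theorem abs_kernel_add_le_matchedAbs (a b c d : ℝ) :
    |a * c + b * c + a * d - b * d| + |b * d + a * d + b * c - a * c| ≤
      2 * (|a| * matchedAbs a b c d) + 2 * (|b| * matchedAbs b a d c) := by
  refine (abs_kernel_add_abs_kernel_swap_le a b c d).trans ?_
  rw [← mul_add]
  refine mul_le_mul_of_nonneg_left ?_ zero_le_two
  unfold matchedAbs
  rcases lt_trichotomy |a| |b| with h | h | h <;> rcases le_total |c| |d| with h' | h' <;>
    simp only [h, h.not_gt, h', lt_irrefl, if_true, if_false, max_eq_left, max_eq_right,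
      min_eq_left, min_eq_right] <;> refine max_le ?_ ?_ <;> nlinarith

/-! ### Norms on the square of a probability space -/

section

variable {Ω : Type*} [MeasurableSpace Ω] {μ : Measure Ω} [IsProbabilityMeasure μ]

/-- If on each orbit `{z, z.swap}` the values of `|U|` are weakly majorized by those of `|V|`, then
the `L^r` norm of `U` on the square is at most that of `V`. -/
theorem eLpNorm_le_of_swap_majorized {U V : Ω × Ω → ℝ} (hU : Measurable U) (hV : Measurable V)
    {r : ENNReal} (hr : 1 ≤ r) (hmax : ∀ z, |U z| ≤ max |V z| |V z.swap|)
    (hsum : ∀ z, |U z| + |U z.swap| ≤ |V z| + |V z.swap|) :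
    eLpNorm U r (μ.prod μ) ≤ eLpNorm V r (μ.prod μ) := by
  have hswap : MeasurePreserving Prod.swap (μ.prod μ) (μ.prod μ) := Measure.measurePreserving_swap
  rcases eq_or_ne r ⊤ with rfl | hrt
  · rw [eLpNorm_exponent_top, eLpNorm_exponent_top]
    refine eLpNormEssSup_le_of_ae_enorm_bound ?_
    have hb : ∀ᵐ z ∂(μ.prod μ), ‖V z‖ₑ ≤ eLpNormEssSup V (μ.prod μ) := ae_le_eLpNormEssSup
    filter_upwards [hb, hswap.quasiMeasurePreserving.ae hb] with z h1 h2
    rcases le_max_iff.1 (hmax z) with h | h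
    · exact (enorm_le_iff_norm_le.2 h).trans h1
    · exact (enorm_le_iff_norm_le.2 h).trans h2
  have hr0 : r ≠ 0 := (zero_lt_one.trans_le hr).ne'
  have hs : 1 ≤ r.toReal := by
    simpa using ENNReal.toReal_mono hrt hr
  have hs0 : 0 ≤ r.toReal := by linarith
  rw [eLpNorm_eq_lintegral_rpow_enorm_toReal hr0 hrt, eLpNorm_eq_lintegral_rpow_enorm_toReal hr0 hrt]
  refine ENNReal.rpow_le_rpow ?_ (by positivity)
  have symm : ∀ W : Ω × Ω → ℝ, Measurable W →
      2 * ∫⁻ z, ‖W z‖ₑ ^ r.toReal ∂(μ.prod μ) =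
        ∫⁻ z, (‖W z‖ₑ ^ r.toReal + ‖W z.swap‖ₑ ^ r.toReal) ∂(μ.prod μ) := by
    intro W hW
    have hm : Measurable fun z => ‖W z‖ₑ ^ r.toReal := hW.enorm.pow_const _
    rw [lintegral_add_left hm, hswap.lintegral_comp hm, two_mul]
  rw [← ENNReal.mul_le_mul_iff_right (a := 2) (by simp) (by simp), symm U hU, symm V hV]
  refine lintegral_mono fun z => ?_
  have key := rpow_add_rpow_le_of_majorized (abs_nonneg _) (abs_nonneg _) (abs_nonneg _)
    (abs_nonneg _) hs (hmax z) (by simpa [max_comm] using hmax z.swap) (hsum z)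
  have conv : ∀ a b : ℝ, ‖a‖ₑ ^ r.toReal + ‖b‖ₑ ^ r.toReal =
      ENNReal.ofReal (|a| ^ r.toReal + |b| ^ r.toReal) := by
    intro a b
    rw [ENNReal.ofReal_add (by positivity) (by positivity),
      ← ENNReal.ofReal_rpow_of_nonneg (abs_nonneg a) hs0,
      ← ENNReal.ofReal_rpow_of_nonneg (abs_nonneg b) hs0, Real.enorm_eq_ofReal_abs,
      Real.enorm_eq_ofReal_abs]
  simp only [conv]
  exact ENNReal.ofReal_le_ofReal key

/-- Jensen's inequality: integrating out one variable does not increase the `L^r` norm. -/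
theorem eLpNorm_integral_prod_le {K : Ω × Ω → ℝ} (hK : Measurable K) {r : ENNReal} (hr : 1 ≤ r) :
    eLpNorm (fun x => ∫ y, K (x, y) ∂μ) r μ ≤ eLpNorm K r (μ.prod μ) := by
  have hsec : ∀ x, ‖∫ y, K (x, y) ∂μ‖ₑ ≤ eLpNorm (fun y => K (x, y)) r μ := fun x => by
    refine (enorm_integral_le_lintegral_enorm _).trans ?_
    rw [← eLpNorm_one_eq_lintegral_enorm]
    exact eLpNorm_le_eLpNorm_of_exponent_le hr
      (hK.comp measurable_prodMk_left).aestronglyMeasurable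
  rcases eq_or_ne r ⊤ with rfl | hrt
  · simp only [eLpNorm_exponent_top] at hsec ⊢
    refine eLpNormEssSup_le_of_ae_enorm_bound ?_
    have hb : ∀ᵐ z ∂(μ.prod μ), ‖K z‖ₑ ≤ eLpNormEssSup K (μ.prod μ) := ae_le_eLpNormEssSup
    filter_upwards [Measure.ae_ae_of_ae_prod hb] with x hx
    exact (hsec x).trans (eLpNormEssSup_le_of_ae_enorm_bound hx)
  have hr0 : r ≠ 0 := (zero_lt_one.trans_le hr).ne'
  have hs : 0 < r.toReal := ENNReal.toReal_pos hr0 hrt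
  simp only [eLpNorm_eq_lintegral_rpow_enorm_toReal hr0 hrt] at hsec ⊢
  rw [lintegral_prod _ (hK.enorm.pow_const _).aemeasurable]
  refine ENNReal.rpow_le_rpow (lintegral_mono fun x => ?_) (by positivity)
  have := ENNReal.rpow_le_rpow (hsec x) hs.le
  rwa [← ENNReal.rpow_mul, one_div_mul_cancel hs.ne', ENNReal.rpow_one] at this

/-! ### The Leibniz inequality -/

/-- The one-sided estimate for measurable functions; measurability makes `matchedAbs` measurable on
the square. -/
theorem eLpNorm_centered_mul_le_of_measurable {f G : Ω → ℝ} (hf : Measurable f) (hG : Measurable G)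
    (hfi : Integrable f μ) (hGi : Integrable G μ) (hfGi : Integrable (fun x => f x * G x) μ)
    (hG0 : ∫ x, G x ∂μ = 0) {p q r : ENNReal} (hr : 1 ≤ r) (hq : 1 ≤ q)
    [p.HolderTriple q r] :
    eLpNorm (fun x => f x * G x + (∫ y, f y ∂μ) * G x - ∫ y, f y * G y ∂μ) r μ ≤
      2 * (eLpNorm f p μ * eLpNorm G q μ) := by
  have hf1 : Measurable fun z : Ω × Ω => f z.1 := hf.comp measurable_fst
  have hf2 : Measurable fun z : Ω × Ω => f z.2 := hf.comp measurable_snd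
  have hG1 : Measurable fun z : Ω × Ω => G z.1 := hG.comp measurable_fst
  have hG2 : Measurable fun z : Ω × Ω => G z.2 := hG.comp measurable_snd
  let R : Ω × Ω → ℝ := fun z => f z.1 * G z.1 + f z.2 * G z.1 + f z.1 * G z.2 - f z.2 * G z.2
  let T : Ω × Ω → ℝ := fun z => matchedAbs (f z.1) (f z.2) (G z.1) (G z.2)
  have hR : Measurable R := by fun_prop
  have hT : Measurable T :=
    Measurable.ite (measurableSet_lt hf2.abs hf1.abs) (hG1.abs.max hG2.abs)
      (Measurable.ite (measurableSet_lt hf1.abs hf2.abs) (hG1.abs.min hG2.abs) hG1.abs)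
  have hint : ∀ x, f x * G x + (∫ y, f y ∂μ) * G x - ∫ y, f y * G y ∂μ = ∫ y, R (x, y) ∂μ := by
    intro x
    have i1 : Integrable (fun y => f x * G x + f y * G x) μ :=
      (integrable_const _).add (hfi.mul_const _)
    have i2 : Integrable (fun y => f x * G y) μ := hGi.const_mul _
    have i3 : Integrable (fun y => f x * G x + f y * G x + f x * G y) μ := i1.add i2
    simp only [R]
    rw [integral_sub i3 hfGi, integral_add i1 i2,
      integral_add (integrable_const _) (hfi.mul_const _), integral_mul_const (G x) f,
      integral_const_mul (f x) G, hG0]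
    simp
  have hRT : eLpNorm R r (μ.prod μ) ≤ eLpNorm ((2 : ℝ) • ((fun z : Ω × Ω => f z.1) • T)) r (μ.prod μ) := by
    have habs : ∀ z, |((2 : ℝ) • ((fun z : Ω × Ω => f z.1) • T)) z| = 2 * (|f z.1| * T z) := by
      intro z
      simp [T, abs_mul, abs_of_nonneg (matchedAbs_nonneg _ _ _ _)]
    refine eLpNorm_le_of_swap_majorized hR ((hf1.smul hT).const_smul _) hr (fun z => ?_)
      fun z => ?_
    · rw [habs, habs]
      exact abs_kernel_le_max_matchedAbs _ _ _ _
    · rw [habs, habs]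
      exact abs_kernel_add_le_matchedAbs _ _ _ _
  have hTG : eLpNorm T q (μ.prod μ) ≤ eLpNorm (fun z : Ω × Ω => G z.1) q (μ.prod μ) := by
    refine eLpNorm_le_of_swap_majorized hT hG1 hq (fun z => ?_) fun z => ?_
    · rcases matchedAbs_cases (f z.1) (f z.2) (G z.1) (G z.2) with h | h <;>
        simp [T, h.1]
    · rcases matchedAbs_cases (f z.1) (f z.2) (G z.1) (G z.2) with h | h <;>
        simp [T, h.1, h.2, add_comm]
  have hfst : ∀ (u : Ω → ℝ) (s : ENNReal), Measurable u →
      eLpNorm (fun z : Ω × Ω => u z.1) s (μ.prod μ) = eLpNorm u s μ := fun u s hu =>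
    eLpNorm_comp_measurePreserving hu.aestronglyMeasurable measurePreserving_fst
  simp only [hint]
  calc eLpNorm (fun x => ∫ y, R (x, y) ∂μ) r μ ≤ eLpNorm R r (μ.prod μ) :=
        eLpNorm_integral_prod_le hR hr
    _ ≤ 2 * eLpNorm ((fun z : Ω × Ω => f z.1) • T) r (μ.prod μ) := by
        refine hRT.trans_eq ?_
        rw [eLpNorm_const_smul]
        simp [Real.enorm_eq_ofReal_abs]
    _ ≤ 2 * (eLpNorm (fun z : Ω × Ω => f z.1) p (μ.prod μ) * eLpNorm T q (μ.prod μ)) := by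
        gcongr
        exact eLpNorm_smul_le_mul_eLpNorm hT.aestronglyMeasurable hf1.aestronglyMeasurable
    _ ≤ 2 * (eLpNorm (fun z : Ω × Ω => f z.1) p (μ.prod μ) *
          eLpNorm (fun z : Ω × Ω => G z.1) q (μ.prod μ)) := by gcongr
    _ = _ := by rw [hfst f p hf, hfst G q hG]

/-- The one-sided estimate. Twice `fg - 𝔼(fg)` is the sum of the function on the left for
`(f, g - 𝔼 g)` and the one for `(g, f - 𝔼 f)`. -/
theorem eLpNorm_centered_mul_le {f G : Ω → ℝ} (hf : MemLp f ⊤ μ) (hG : MemLp G ⊤ μ)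
    (hG0 : ∫ x, G x ∂μ = 0) {p q r : ENNReal} (hr : 1 ≤ r) (hq : 1 ≤ q) [p.HolderTriple q r] :
    eLpNorm (fun x => f x * G x + (∫ y, f y ∂μ) * G x - ∫ y, f y * G y ∂μ) r μ ≤
      2 * (eLpNorm f p μ * eLpNorm G q μ) := by
  obtain ⟨f', hf', hff'⟩ := hf.1.aemeasurable
  obtain ⟨G', hG', hGG'⟩ := hG.1.aemeasurable
  have hfi : Integrable f μ := hf.integrable le_top
  have hGi : Integrable G μ := hG.integrable le_top
  have hfGi : Integrable (fun x => f x * G x) μ := (hG.mul (r := ⊤) hf).integrable le_top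
  have hmul : (fun x => f x * G x) =ᵐ[μ] fun x => f' x * G' x := hff'.mul hGG'
  have key := eLpNorm_centered_mul_le_of_measurable (p := p) hf' hG' (hfi.congr hff')
    (hGi.congr hGG') (hfGi.congr hmul) (by rw [← integral_congr_ae hGG', hG0]) hr hq
  rw [eLpNorm_congr_ae hff', eLpNorm_congr_ae hGG', integral_congr_ae hff', integral_congr_ae hmul]
  refine (eLpNorm_congr_ae ?_).trans_le key
  filter_upwards [hff', hGG'] with x h1 h2
  rw [h1, h2]

end

theorem theorem1 {Ω : Type*} [MeasurableSpace Ω] (μ : MeasureTheory.Measure Ω)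
    [MeasureTheory.IsProbabilityMeasure μ] (f g : Ω → ℝ)
    (hf : MeasureTheory.MemLp f ⊤ μ) (hg : MeasureTheory.MemLp g ⊤ μ)
    (r p₁ q₁ p₂ q₂ : ENNReal)
    (hr : 1 ≤ r) (hp₁ : 1 ≤ p₁) (hq₁ : 1 ≤ q₁) (hp₂ : 1 ≤ p₂) (hq₂ : 1 ≤ q₂)
    (h₁ : 1 / r = 1 / p₁ + 1 / q₁) (h₂ : 1 / r = 1 / p₂ + 1 / q₂) :
    MeasureTheory.eLpNorm (fun x => f x * g x - ∫ y, f y * g y ∂μ) r μ ≤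
      MeasureTheory.eLpNorm f p₁ μ *
          MeasureTheory.eLpNorm (fun x => g x - ∫ y, g y ∂μ) q₁ μ +
        MeasureTheory.eLpNorm g p₂ μ *
          MeasureTheory.eLpNorm (fun x => f x - ∫ y, f y ∂μ) q₂ μ := by
  have : p₁.HolderTriple q₁ r := ⟨by simpa using h₁.symm⟩
  have : p₂.HolderTriple q₂ r := ⟨by simpa using h₂.symm⟩
  have hfi : Integrable f μ := hf.integrable le_top
  have hgi : Integrable g μ := hg.integrable le_top
  have hfgi : Integrable (fun x => f x * g x) μ := (hg.mul (r := ⊤) hf).integrable le_top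
  obtain ⟨a, ha⟩ : ∃ a, a = ∫ y, f y ∂μ := ⟨_, rfl⟩
  obtain ⟨b, hb⟩ : ∃ b, b = ∫ y, g y ∂μ := ⟨_, rfl⟩
  have hF : MemLp (fun x => f x - a) ⊤ μ := hf.sub (memLp_const a)
  have hG : MemLp (fun x => g x - b) ⊤ μ := hg.sub (memLp_const b)
  have hF0 : ∫ x, (f x - a) ∂μ = 0 := by
    rw [integral_sub hfi (integrable_const _)]; simp [ha]
  have hG0 : ∫ x, (g x - b) ∂μ = 0 := by
    rw [integral_sub hgi (integrable_const _)]; simp [hb]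
  have k1 := eLpNorm_centered_mul_le (p := p₁) hf hG hG0 hr hq₁
  have k2 := eLpNorm_centered_mul_le (p := p₂) hg hF hF0 hr hq₂
  have e1 : ∫ y, f y * (g y - b) ∂μ = ∫ y, f y * g y ∂μ - a * b := by
    simp only [mul_sub]
    rw [integral_sub hfgi (hfi.mul_const _), integral_mul_const, ha]
  have e2 : ∫ y, g y * (f y - a) ∂μ = ∫ y, f y * g y ∂μ - a * b := by
    simp only [mul_sub, mul_comm (g _) (f _)]
    rw [integral_sub hfgi (hgi.mul_const _), integral_mul_const, hb, mul_comm]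
  rw [e1, ← ha] at k1
  rw [e2, ← hb] at k2
  rw [← ha, ← hb]
  obtain ⟨c, hc⟩ : ∃ c, c = ∫ y, f y * g y ∂μ := ⟨_, rfl⟩
  rw [← hc] at k1 k2 ⊢
  have hsplit : (2 : ℝ) • (fun x => f x * g x - c) =
      (fun x => f x * (g x - b) + a * (g x - b) - (c - a * b)) +
        fun x => g x * (f x - a) + b * (f x - a) - (c - a * b) := by
    funext x
    simp only [Pi.smul_apply, Pi.add_apply, smul_eq_mul]
    ring
  have hf_meas := hf.1
  have hg_meas := hg.1
  rw [← ENNReal.mul_le_mul_iff_right (a := 2) (by simp) (by simp)]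
  calc 2 * eLpNorm (fun x => f x * g x - c) r μ
      = eLpNorm ((2 : ℝ) • (fun x => f x * g x - c)) r μ := by
        rw [eLpNorm_const_smul]
        simp [Real.enorm_eq_ofReal_abs]
    _ ≤ _ := by
        rw [hsplit]
        exact eLpNorm_add_le (by fun_prop) (by fun_prop) hr
    _ ≤ _ := add_le_add k1 k2
    _ = _ := by rw [mul_add]
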